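/- **Lemma.** Let $m,n$ be natural numbers and let $\rho$ be any bipartite state on $\mathbb{C}^m\otimes\mathbb{C}^n$, i.e. a positive semidefinite operator with $\operatorname{tr}\rho=1$. Let $$S_{\max}(\rho)=\max_{A_0,A_1,B_0,B_1}\ \operatorname{tr}\Big(\sum_{a,b\in\{0,1\}}(-1)^{ab}\,(A_a\otimes B_b)\,\rho\Big),$$ where $A_0,A_1$ range over the Hermitian operators on $\mathbb{C}^m$ and $B_0,B_1$ over the Hermitian operators on $\mathbb{C}^n$ all of whose eigenvalues lie in $\{1,-1\}$. Let $$F_{LOCC}(\rho)=\sup_{\Phi}\ F\big(\Phi(\rho),|\phi_+\rangle\langle\phi_+|\big),\qquad |\phi_+\rangle=\tfrac{1}{\sqrt2}\big(|00\rangle+|11\rangle\big),$$ where $\Phi$ ranges over all maps from operators on $\mathbb{C}^m\otimes\mathbb{C}^n$ to operators on $\mathbb{C}^2\otimes\mathbb{C}^2$ that are implemented by local operations and classical communication with finitely many rounds (in each round one party applies a local quantum instrument and communicates the outcome, and everything that follows may depend on the outcomes so far), and $F(\sigma,\tau)=\big(\operatorname{tr}\sqrt{\sqrt{\sigma}\,\tau\sqrt{\sigma}}\big)^2$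 is the fidelity, so that $F(\sigma,|\psi\rangle\langle\psi|)=\langle\psi|\sigma|\psi\rangle$. Then $$F_{LOCC}(\rho)\ \ge\ \frac{S_{\max}(\rho)+2\sqrt2-4}{4(\sqrt2-1)}.$$ -/

import Mathlib

open scoped Matrix Kronecker ComplexOrder MatrixOrder

noncomputable section

/-! ### States and the CHSH value -/

/-- A quantum state on the Hilbert space `ℂ^ι`: a positive semidefinite matrix of trace one. A
bipartite state on `ℂ^m ⊗ ℂ^n` is a state with `ι = Fin m × Fin n`. -/
def IsDensityMatrix {ι : Type*} [Fintype ι] (ρ : Matrix ι ι ℂ) : Prop :=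
  ρ.PosSemidef ∧ ρ.trace = 1

/-- A two-outcome observable: a Hermitian matrix all of whose eigenvalues are `1` or `-1`, that is,
a Hermitian matrix that squares to the identity. (A fixed outcome, `A = 1` or `A = -1`, is
allowed.) -/
def IsBinaryObservable {ι : Type*} [Fintype ι] [DecidableEq ι] (A : Matrix ι ι ℂ) : Prop :=
  A.IsHermitian ∧ A * A = 1

/-- The CHSH operator `∑_{a,b ∈ {0,1}} (-1)^{ab} A_a ⊗ B_b`. -/
def chshOperator {ι κ : Type*} (A : Fin 2 → Matrix ι ι ℂ) (B : Fin 2 → Matrix κ κ ℂ) :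
    Matrix (ι × κ) (ι × κ) ℂ :=
  ∑ a : Fin 2, ∑ b : Fin 2, (-1 : ℂ) ^ ((a : ℕ) * (b : ℕ)) • (A a ⊗ₖ B b)

/-- The CHSH value `S = tr (CHSH ρ)` (a real number for Hermitian `ρ`, `A_a`, `B_b`). -/
def chshValue {ι κ : Type*} [Fintype ι] [Fintype κ] (A : Fin 2 → Matrix ι ι ℂ)
    (B : Fin 2 → Matrix κ κ ℂ) (ρ : Matrix (ι × κ) (ι × κ) ℂ) : ℝ :=
  (chshOperator A B * ρ).trace.re

/-- All CHSH values that two-outcome observables can reach on `ρ`. -/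
def chshValues {ι κ : Type*} [Fintype ι] [DecidableEq ι] [Fintype κ] [DecidableEq κ]
    (ρ : Matrix (ι × κ) (ι × κ) ℂ) : Set ℝ :=
  {s | ∃ (A : Fin 2 → Matrix ι ι ℂ) (B : Fin 2 → Matrix κ κ ℂ),
    (∀ a, IsBinaryObservable (A a)) ∧ (∀ b, IsBinaryObservable (B b)) ∧ s = chshValue A B ρ}

/-- `S_max(ρ)`: the maximal CHSH value of `ρ` over all measurements. -/
def Smax {ι κ : Type*} [Fintype ι] [DecidableEq ι] [Fintype κ] [DecidableEq κ]
    (ρ : Matrix (ι × κ) (ι × κ) ℂ) : ℝ :=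
  sSup (chshValues ρ)

/-! ### Fidelity with the maximally entangled pair of qubits -/

/-- The fidelity `F(σ, τ) = (tr √(√σ τ √σ))²`, in the convention in which
`F(σ, |ψ⟩⟨ψ|) = ⟨ψ|σ|ψ⟩`. -/
def fidelity {ι : Type*} [Fintype ι] [DecidableEq ι] (σ τ : Matrix ι ι ℂ) : ℝ :=
  ((CFC.sqrt (CFC.sqrt σ * τ * CFC.sqrt σ)).trace.re) ^ 2

/-- The vector `|φ₊⟩ = (|00⟩ + |11⟩) / √2`. -/
def phiPlus : Fin 2 × Fin 2 → ℂ := fun x => if x.1 = x.2 then ((1 / √2 : ℝ) : ℂ) else 0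

/-- The projector `|φ₊⟩⟨φ₊|`. -/
def phiPlusProj : Matrix (Fin 2 × Fin 2) (Fin 2 × Fin 2) ℂ :=
  Matrix.vecMulVec phiPlus (star phiPlus)

/-! ### LOCC maps -/

/-- The linear map `ρ ↦ M ρ M†`. -/
def conjMap {ι κ : Type*} [Fintype ι] [Fintype κ] (M : Matrix κ ι ℂ) :
    Matrix ι ι ℂ →ₗ[ℂ] Matrix κ κ ℂ where
  toFun ρ := M * ρ * Mᴴ
  map_add' ρ σ := by rw [Matrix.mul_add, Matrix.add_mul]
  map_smul' c ρ := by simp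

/-- `IsLOCC c d a b Φ`: the linear map `Φ`, from operators on `ℂ^a ⊗ ℂ^b` to operators on
`ℂ^c ⊗ ℂ^d`, is implemented by a protocol of finitely many rounds of local operations and classical
communication. The protocol either stops, or one party performs a local quantum instrument with
Kraus operators `K 0, …, K (k-1)` (possibly into a space whose dimension depends on the outcome),
the outcome `i` is communicated to the other party, and they go on with an LOCC protocol `Φ i` that
may depend on `i`. The map is the average over all outcomes.

Instruments whose branches are completely positive maps with several Kraus operators are covered:
list all Kraus operators, and use the same continuation for those that belong to one branch. -/
inductive IsLOCC (c d : ℕ) : (a b : ℕ) →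
    (Matrix (Fin a × Fin b) (Fin a × Fin b) ℂ →ₗ[ℂ] Matrix (Fin c × Fin d) (Fin c × Fin d) ℂ) →
    Prop
  | done : IsLOCC c d c d LinearMap.id
  | alice {a b k : ℕ} (a' : Fin k → ℕ) (K : (i : Fin k) → Matrix (Fin (a' i)) (Fin a) ℂ)
      (hK : ∑ i, (K i)ᴴ * K i = 1)
      (Φ : (i : Fin k) → Matrix (Fin (a' i) × Fin b) (Fin (a' i) × Fin b) ℂ →ₗ[ℂ]
        Matrix (Fin c × Fin d) (Fin c × Fin d) ℂ)
      (hΦ : ∀ i, IsLOCC c d (a' i) b (Φ i)) :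
      IsLOCC c d a b (∑ i, (Φ i).comp (conjMap (K i ⊗ₖ (1 : Matrix (Fin b) (Fin b) ℂ))))
  | bob {a b k : ℕ} (b' : Fin k → ℕ) (K : (i : Fin k) → Matrix (Fin (b' i)) (Fin b) ℂ)
      (hK : ∑ i, (K i)ᴴ * K i = 1)
      (Φ : (i : Fin k) → Matrix (Fin a × Fin (b' i)) (Fin a × Fin (b' i)) ℂ →ₗ[ℂ]
        Matrix (Fin c × Fin d) (Fin c × Fin d) ℂ)
      (hΦ : ∀ i, IsLOCC c d a (b' i) (Φ i)) :
      IsLOCC c d a b (∑ i, (Φ i).comp (conjMap ((1 : Matrix (Fin a) (Fin a) ℂ) ⊗ₖ K i)))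

/-- All fidelities with `|φ₊⟩` of the two-qubit states that LOCC maps can make out of `ρ`. -/
def loccFidelities {m n : ℕ} (ρ : Matrix (Fin m × Fin n) (Fin m × Fin n) ℂ) : Set ℝ :=
  {f | ∃ Φ : Matrix (Fin m × Fin n) (Fin m × Fin n) ℂ →ₗ[ℂ]
      Matrix (Fin 2 × Fin 2) (Fin 2 × Fin 2) ℂ,
    IsLOCC 2 2 m n Φ ∧ f = fidelity (Φ ρ) phiPlusProj}

/-- `F_LOCC(ρ)`: the best fidelity with `|φ₊⟩` of a pair of qubits obtained from `ρ` by LOCC. -/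
def FLOCC {m n : ℕ} (ρ : Matrix (Fin m × Fin n) (Fin m × Fin n) ℂ) : ℝ :=
  sSup (loccFidelities ρ)

/-! ### The suprema are over nonempty bounded sets, and the fidelity with a pure state -/

theorem chshValues_nonempty {ι κ : Type*} [Fintype ι] [DecidableEq ι] [Fintype κ] [DecidableEq κ]
    (ρ : Matrix (ι × κ) (ι × κ) ℂ) : (chshValues ρ).Nonempty :=
  ⟨_, fun _ => 1, fun _ => 1, fun _ => ⟨Matrix.isHermitian_one, by simp⟩,
    fun _ => ⟨Matrix.isHermitian_one, by simp⟩, rfl⟩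

theorem IsBinaryObservable.norm_entry_le {ι : Type*} [Fintype ι] [DecidableEq ι]
    {A : Matrix ι ι ℂ} (hA : IsBinaryObservable A) (i j : ι) : ‖A i j‖ ≤ 1 := by
  refine entry_norm_bound_of_unitary (U := A) ?_ i j
  rw [Matrix.mem_unitaryGroup_iff, Matrix.star_eq_conjTranspose, hA.1.eq, hA.2]

theorem chshValues_bddAbove {ι κ : Type*} [Fintype ι] [DecidableEq ι] [Fintype κ] [DecidableEq κ]
    (ρ : Matrix (ι × κ) (ι × κ) ℂ) : BddAbove (chshValues ρ) := by
  refine ⟨∑ x : ι × κ, ∑ y : ι × κ, 4 * ‖ρ y x‖, ?_⟩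
  rintro s ⟨A, B, hA, hB, rfl⟩
  refine (Complex.re_le_norm _).trans ?_
  rw [Matrix.trace]
  refine (norm_sum_le _ _).trans (Finset.sum_le_sum fun x _ => ?_)
  rw [Matrix.diag_apply, Matrix.mul_apply]
  refine (norm_sum_le _ _).trans (Finset.sum_le_sum fun y _ => ?_)
  rw [norm_mul]
  refine mul_le_mul_of_nonneg_right ?_ (norm_nonneg _)
  have h : ∀ a b, ‖A a x.1 y.1 * B b x.2 y.2‖ ≤ 1 := fun a b => by
    rw [norm_mul]
    exact mul_le_one₀ ((hA a).norm_entry_le _ _) (norm_nonneg _) ((hB b).norm_entry_le _ _)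
  have h00 := h 0 0
  have h01 := h 0 1
  have h10 := h 1 0
  have h11 := h 1 1
  simp only [chshOperator, Fin.sum_univ_two, Matrix.add_apply, Matrix.smul_apply,
    Matrix.kroneckerMap_apply]
  refine (norm_add_le _ _).trans ((add_le_add (norm_add_le _ _) (norm_add_le _ _)).trans ?_)
  simp only [norm_smul, norm_pow, norm_neg, norm_one, one_pow, one_mul] at *
  linarith

theorem IsLOCC.posSemidef {c d a b : ℕ}
    {Φ : Matrix (Fin a × Fin b) (Fin a × Fin b) ℂ →ₗ[ℂ] Matrix (Fin c × Fin d) (Fin c × Fin d) ℂ}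
    (h : IsLOCC c d a b Φ) {ρ : Matrix (Fin a × Fin b) (Fin a × Fin b) ℂ} (hρ : ρ.PosSemidef) :
    (Φ ρ).PosSemidef := by
  induction h with
  | done => exact hρ
  | alice a' K hK Φ hΦ ih =>
    simp only [LinearMap.sum_apply, LinearMap.comp_apply]
    exact Matrix.posSemidef_sum _ fun i _ => ih i (hρ.mul_mul_conjTranspose_same _)
  | bob a' K hK Φ hΦ ih =>
    simp only [LinearMap.sum_apply, LinearMap.comp_apply]
    exact Matrix.posSemidef_sum _ fun i _ => ih i (hρ.mul_mul_conjTranspose_same _)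

theorem IsLOCC.trace_eq {c d a b : ℕ}
    {Φ : Matrix (Fin a × Fin b) (Fin a × Fin b) ℂ →ₗ[ℂ] Matrix (Fin c × Fin d) (Fin c × Fin d) ℂ}
    (h : IsLOCC c d a b Φ) (ρ : Matrix (Fin a × Fin b) (Fin a × Fin b) ℂ) :
    (Φ ρ).trace = ρ.trace := by
  induction h with
  | done => rfl
  | @alice a b k a' K hK Φ hΦ ih =>
    have : ∀ i, ((Φ i) (conjMap (K i ⊗ₖ 1) ρ)).trace = ((((K i)ᴴ * K i) ⊗ₖ 1) * ρ).trace := by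
      intro i
      rw [ih i]
      simp only [conjMap, LinearMap.coe_mk, AddHom.coe_mk]
      rw [Matrix.trace_mul_comm, ← Matrix.mul_assoc, Matrix.conjTranspose_kronecker,
        ← Matrix.mul_kronecker_mul]
      simp
    simp only [LinearMap.sum_apply, LinearMap.comp_apply, Matrix.trace_sum, this]
    rw [← Matrix.trace_sum, ← Finset.sum_mul]
    have h2 : ∑ i, (((K i)ᴴ * K i) ⊗ₖ (1 : Matrix (Fin b) (Fin b) ℂ)) =
        (∑ i, (K i)ᴴ * K i) ⊗ₖ 1 := by
      ext x y; simp [Matrix.sum_apply, Finset.sum_mul]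
    rw [h2, hK]; simp
  | @bob a b k b' K hK Φ hΦ ih =>
    have : ∀ i, ((Φ i) (conjMap (1 ⊗ₖ K i) ρ)).trace = ((1 ⊗ₖ ((K i)ᴴ * K i)) * ρ).trace := by
      intro i
      rw [ih i]
      simp only [conjMap, LinearMap.coe_mk, AddHom.coe_mk]
      rw [Matrix.trace_mul_comm, ← Matrix.mul_assoc, Matrix.conjTranspose_kronecker,
        ← Matrix.mul_kronecker_mul]
      simp
    simp only [LinearMap.sum_apply, LinearMap.comp_apply, Matrix.trace_sum, this]
    rw [← Matrix.trace_sum, ← Finset.sum_mul]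
    have h2 : ∑ i, ((1 : Matrix (Fin a) (Fin a) ℂ) ⊗ₖ ((K i)ᴴ * K i)) =
        1 ⊗ₖ (∑ i, (K i)ᴴ * K i) := by
      ext x y; simp [Matrix.sum_apply, Finset.mul_sum]
    rw [h2, hK]; simp

theorem fidelity_vecMulVec {ι : Type*} [Fintype ι] [DecidableEq ι] {σ : Matrix ι ι ℂ}
    (hσ : σ.PosSemidef) (v : ι → ℂ) :
    fidelity σ (Matrix.vecMulVec v (star v)) = (star v ⬝ᵥ (σ *ᵥ v)).re := by
  have hs : (CFC.sqrt σ).PosSemidef := Matrix.nonneg_iff_posSemidef.mp (CFC.sqrt_nonneg σ)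
  set s := CFC.sqrt σ with hsdef
  have hss : s * s = σ := CFC.sqrt_mul_sqrt_self σ hσ.nonneg
  set w := s *ᵥ v with hw
  have hW : s * Matrix.vecMulVec v (star v) * s = Matrix.vecMulVec w (star w) := by
    rw [Matrix.mul_vecMulVec, Matrix.vecMulVec_mul, hw, Matrix.star_mulVec, hs.1.eq]
  have hc : star v ⬝ᵥ (σ *ᵥ v) = star w ⬝ᵥ w := by
    rw [hw, Matrix.star_mulVec, hs.1.eq, ← hss, ← Matrix.mulVec_mulVec, Matrix.dotProduct_mulVec]
  have hpos : 0 ≤ star w ⬝ᵥ w := dotProduct_star_self_nonneg w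
  obtain ⟨c, hc0, hcw⟩ : ∃ c : ℝ, 0 ≤ c ∧ star w ⬝ᵥ w = (c : ℂ) := by
    rw [Complex.le_def] at hpos
    exact ⟨_, hpos.1, Complex.ext rfl (by simpa using hpos.2.symm)⟩
  have hroot : CFC.sqrt (Matrix.vecMulVec w (star w)) =
      ((√c)⁻¹ : ℂ) • Matrix.vecMulVec w (star w) := by
    refine CFC.sqrt_unique ?_ ?_
    · rw [smul_mul_smul_comm, Matrix.vecMulVec_mul_vecMulVec, hcw]
      rcases hc0.eq_or_lt with h | h
      · have : w = 0 := dotProduct_star_self_eq_zero.mp (by rw [hcw, ← h]; simp)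
        simp [this]
      · rw [Matrix.vecMulVec_smul, smul_smul, ← mul_inv, ← Complex.ofReal_mul,
          Real.mul_self_sqrt hc0, inv_mul_cancel₀ (by exact_mod_cast h.ne'), one_smul]
    · refine ((Matrix.posSemidef_vecMulVec_self_star w).smul ?_).nonneg
      rw [← Complex.ofReal_inv]
      exact_mod_cast inv_nonneg.mpr (Real.sqrt_nonneg c)
  rw [fidelity, hW, hroot, hc, Matrix.trace_smul, Matrix.trace_vecMulVec, dotProduct_comm, hcw]
  rw [smul_eq_mul, ← Complex.ofReal_inv, ← Complex.ofReal_mul, Complex.ofReal_re, Complex.ofReal_re]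
  rcases hc0.eq_or_lt with h | h
  · simp [← h]
  · rw [mul_pow, inv_pow, Real.sq_sqrt hc0]; field_simp

theorem fidelity_phiPlusProj_le {σ : Matrix (Fin 2 × Fin 2) (Fin 2 × Fin 2) ℂ}
    (hσ : σ.PosSemidef) : fidelity σ phiPlusProj ≤ σ.trace.re := by
  rw [phiPlusProj, fidelity_vecMulVec hσ]
  have h1 := hσ.dotProduct_mulVec_nonneg (fun x => if x.1 = x.2 then (if x.1 = 0 then 1 else -1) else 0)
  have h3 := hσ.diag_nonneg (i := (0,1))
  have h4 := hσ.diag_nonneg (i := (1,0))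
  have hsq : ((√2:ℝ):ℂ)⁻¹ * ((√2:ℝ):ℂ)⁻¹ = ((1/2 : ℝ):ℂ) := by
    rw [← mul_inv, ← Complex.ofReal_mul, Real.mul_self_sqrt (by norm_num)]; norm_num
  have hsq' : (√2)⁻¹ * (√2)⁻¹ = (1/2 : ℝ) := by rw [← mul_inv, Real.mul_self_sqrt (by norm_num)]; norm_num
  rw [Complex.le_def] at h1 h3 h4
  have h1 := h1.1; have h3 := h3.1; have h4 := h4.1
  simp [phiPlus, dotProduct, Matrix.mulVec, Fintype.sum_prod_type, Matrix.trace, Complex.inv_re] at *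
  field_simp
  norm_num
  linarith

theorem loccFidelities_bddAbove {m n : ℕ} {ρ : Matrix (Fin m × Fin n) (Fin m × Fin n) ℂ}
    (hρ : IsDensityMatrix ρ) : BddAbove (loccFidelities ρ) := by
  refine ⟨1, ?_⟩
  rintro f ⟨Φ, h, rfl⟩
  have := fidelity_phiPlusProj_le (h.posSemidef hρ.1)
  rwa [h.trace_eq, hρ.2, Complex.one_re] at this

theorem sum_single_conjTranspose_mul_self (k : ℕ) :
    ∑ i : Fin k, (Matrix.single (0 : Fin 2) i (1 : ℂ))ᴴ * Matrix.single (0 : Fin 2) i (1 : ℂ) =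
      1 := by
  simp [Matrix.conjTranspose_single, Matrix.sum_single_one]

theorem loccFidelities_nonempty {m n : ℕ} (ρ : Matrix (Fin m × Fin n) (Fin m × Fin n) ℂ) :
    (loccFidelities ρ).Nonempty :=
  ⟨_, _, IsLOCC.alice (fun _ => 2) _ (sum_single_conjTranspose_mul_self m) _ fun _ =>
    IsLOCC.bob (fun _ => 2) _ (sum_single_conjTranspose_mul_self n) _ fun _ => IsLOCC.done, rfl⟩

end

/-! Jordan's lemma reduces everything to qubits. If `v` is a unit eigenvector of the unitary `A 0 *
A 1`, then `v` and `A 0 v` span a space invariant under both observables. Measuring along these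
spaces is a local instrument intertwining each party's observables with antidiagonal qubit ones, so
the CHSH value is the sum of the CHSH values of the unnormalized two-qubit outcomes.

For antidiagonal observables the CHSH operator only sees the coherences between 00, 11 and between
01, 10, with weights `α, β` satisfying `α² + β² = 8`. Three protocols (correct a phase; correct a
phase and flip a bit; prepare 00 afresh) give a fidelity `F` with `S ≤ 2 tr σ + 2(√2 - 1)(2F - tr
σ)`. This bound is linear in `S`, `F` and `tr σ`, so it can be summed over the outcomes. -/

/-! ### Jordan's lemma for two binary observables -/

open scoped Matrix.Norms.L2Operator in
/-- A unitary matrix is unitarily diagonalizable, with diagonal entries on the unit circle. -/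
theorem exists_unitary_diagonalization {ι : Type*} [Fintype ι] [DecidableEq ι]
    {U : Matrix ι ι ℂ} (hU : U ∈ Matrix.unitaryGroup ι ℂ) :
    ∃ (V : Matrix ι ι ℂ) (t : ι → ℝ), V ∈ Matrix.unitaryGroup ι ℂ ∧
      U = V * Matrix.diagonal (fun i => Complex.exp (Complex.I * t i)) * Vᴴ := by
  have hfs : (spectrum ℂ U).Finite := Matrix.spectrum_toLin' U ▸ Module.End.finite_spectrum _
  -- The spectrum is finite, so the discontinuity of `Complex.arg` does not obstruct the functional
  -- calculus; `U = exp(i arg U)` then reduces to the Hermitian spectral theorem.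
  have hfin : ∀ f : ℂ → ℂ, ContinuousOn f (spectrum ℂ U) := hfs.continuousOn
  have hn : IsStarNormal U := isStarNormal_of_mem_unitary hU
  set H : Matrix ι ι ℂ := cfc (fun z => (Complex.arg z : ℂ)) U with hHdef
  have hH : H.IsHermitian := by
    change star H = H
    rw [hHdef, ← cfc_star]
    simp
  have hexp : U = NormedSpace.exp (Complex.I • H) := by
    have : IsStarNormal H := hH.isSelfAdjoint.isStarNormal
    have hN : IsStarNormal (Complex.I • H) := inferInstance
    rw [← CFC.exp_eq_normedSpace_exp (𝕜 := ℂ), ← cfc_comp_smul .., hHdef,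
      ← cfc_comp' (hf := hfin _) (hg := ?hg)]
    case hg => exact (hfs.image _).continuousOn _
    · conv_lhs => rw [← cfc_id' ℂ U]
      refine cfc_congr fun y hy => ?_
      have hy1 : ‖y‖ = 1 := spectrum.norm_eq_one_of_unitary hU hy
      have h := Complex.norm_mul_exp_arg_mul_I y
      rw [hy1, Complex.ofReal_one, one_mul] at h
      rw [← Complex.exp_eq_exp_ℂ, smul_eq_mul, mul_comm, h]
  refine ⟨hH.eigenvectorUnitary, hH.eigenvalues, hH.eigenvectorUnitary.2, ?_⟩
  have hV : (hH.eigenvectorUnitary : Matrix ι ι ℂ)⁻¹ = (hH.eigenvectorUnitary : Matrix ι ι ℂ)ᴴ :=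
    Matrix.inv_eq_left_inv (Matrix.mem_unitaryGroup_iff'.mp hH.eigenvectorUnitary.2)
  have hu : IsUnit (hH.eigenvectorUnitary : Matrix ι ι ℂ) :=
    (Unitary.toUnits hH.eigenvectorUnitary).isUnit
  have hs := hH.spectral_theorem
  rw [Unitary.conjStarAlgAut_apply, Matrix.star_eq_conjTranspose, ← hV] at hs
  conv_lhs => rw [hexp, hs]
  rw [← Matrix.smul_mul, ← Matrix.mul_smul, Matrix.exp_conj _ _ hu, hV, ← Matrix.diagonal_smul,
    Matrix.exp_diagonal]
  congr 3
  ext i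
  simp [Pi.coe_exp, Complex.exp_eq_exp_ℂ]

noncomputable section

/-- The pair of qubit observables `X` and `[[0, μ̄], [μ, 0]]`. -/
def qubitObservables (μ : ℂ) : Fin 2 → Matrix (Fin 2) (Fin 2) ℂ :=
  ![!![0, 1; 1, 0], !![0, star μ; μ, 0]]

/-- The matrix with rows `v† / √2` and `v† A / √2`, for `v` the `i`-th column of `V`. -/
def pairKraus {ι : Type*} [Fintype ι] (A V : Matrix ι ι ℂ) (i : ι) : Matrix (Fin 2) ι ℂ :=
  Matrix.of ![fun j => ((1 / √2 : ℝ) : ℂ) * Vᴴ i j, fun j => ((1 / √2 : ℝ) : ℂ) * (Vᴴ * A) i j]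

theorem one_div_sqrt_two_mul_self :
    ((1 / √2 : ℝ) : ℂ) * ((1 / √2 : ℝ) : ℂ) = 1 / 2 := by
  rw [← Complex.ofReal_mul, div_mul_div_comm, Real.mul_self_sqrt (by norm_num)]
  norm_num

/-- The columns of `V` and those of `A * V` are both orthonormal bases, so together they resolve
twice the identity; the factor `1 / √2` compensates. The two rows may be parallel, so
one-dimensional Jordan blocks need no separate case. -/
theorem sum_conjTranspose_pairKraus_mul_self {ι : Type*} [Fintype ι] [DecidableEq ι]
    {A V : Matrix ι ι ℂ} (hA : IsBinaryObservable A) (hV : V ∈ Matrix.unitaryGroup ι ℂ) :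
    ∑ i, (pairKraus A V i)ᴴ * pairKraus A V i = 1 := by
  have hVV : V * Vᴴ = 1 := Matrix.mem_unitaryGroup_iff.mp hV
  have h2 : (Vᴴ * A)ᴴ * (Vᴴ * A) = 1 := by
    rw [Matrix.conjTranspose_mul, Matrix.conjTranspose_conjTranspose, hA.1.eq, Matrix.mul_assoc,
      ← Matrix.mul_assoc V, hVV, Matrix.one_mul, hA.2]
  have h1 : Vᴴᴴ * Vᴴ = 1 := by rwa [Matrix.conjTranspose_conjTranspose]
  have key : ∑ i, (pairKraus A V i)ᴴ * pairKraus A V i =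
      (1 / 2 : ℂ) • (Vᴴᴴ * Vᴴ + (Vᴴ * A)ᴴ * (Vᴴ * A)) := by
    ext x y
    simp only [Matrix.sum_apply, Matrix.smul_apply, Matrix.add_apply, Matrix.mul_apply (M := Vᴴᴴ),
      Matrix.mul_apply (M := (Vᴴ * A)ᴴ), Matrix.mul_apply (M := (pairKraus A V _)ᴴ),
      Fin.sum_univ_two, ← Finset.sum_add_distrib, Finset.smul_sum]
    refine Finset.sum_congr rfl fun i _ => ?_
    rw [← one_div_sqrt_two_mul_self]
    simp only [pairKraus, Matrix.conjTranspose_apply (M := Matrix.of _), Matrix.of_apply,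
      Matrix.cons_val_zero, Matrix.cons_val_one, star_mul', Complex.star_def, Complex.conj_ofReal,
      Matrix.conjTranspose_apply (M := Vᴴ * A), Matrix.conjTranspose_apply (M := Vᴴ), smul_eq_mul]
    ring
  rw [key, h1, h2, ← two_smul ℂ (1 : Matrix ι ι ℂ), smul_smul]
  norm_num

/-- Two binary observables are, up to Kraus operators into a qubit, direct sums of pairs of qubit
observables (a form of Jordan's lemma). -/
theorem exists_qubit_reduction {ι : Type*} [Fintype ι] [DecidableEq ι]
    {A : Fin 2 → Matrix ι ι ℂ} (hA : ∀ a, IsBinaryObservable (A a)) :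
    ∃ (K : ι → Matrix (Fin 2) ι ℂ) (μ : ι → ℂ), ∑ i, (K i)ᴴ * K i = 1 ∧ (∀ i, ‖μ i‖ = 1) ∧
      ∀ i a, K i * A a = qubitObservables (μ i) a * K i := by
  have hU : A 0 * A 1 ∈ Matrix.unitaryGroup ι ℂ := by
    rw [Matrix.mem_unitaryGroup_iff, Matrix.star_eq_conjTranspose, Matrix.conjTranspose_mul,
      (hA 0).1.eq, (hA 1).1.eq, Matrix.mul_assoc, ← Matrix.mul_assoc (A 1), (hA 1).2,
      Matrix.one_mul, (hA 0).2]
  obtain ⟨V, t, hV, hD⟩ := exists_unitary_diagonalization hU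
  set μ : ι → ℂ := fun i => Complex.exp (Complex.I * t i) with hμ
  have hVV : Vᴴ * V = 1 := Matrix.mem_unitaryGroup_iff'.mp hV
  have h01 : Vᴴ * A 0 * A 1 = Matrix.diagonal μ * Vᴴ := by
    rw [Matrix.mul_assoc, hD, ← Matrix.mul_assoc, ← Matrix.mul_assoc, hVV, Matrix.one_mul]
  have hD' : A 1 * A 0 = V * Matrix.diagonal (star μ) * Vᴴ := by
    have := congrArg Matrix.conjTranspose hD
    rw [Matrix.conjTranspose_mul, (hA 0).1.eq, (hA 1).1.eq] at this
    rw [this]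
    simp [Matrix.mul_assoc, Matrix.diagonal_conjTranspose]
  -- With `h01`, this says `v†A₁ = μ̄ v†A₀` and `v†A₀A₁ = μ v†`: both observables swap the two rows,
  -- up to phases.
  have h1 : Vᴴ * A 1 = Matrix.diagonal (star μ) * (Vᴴ * A 0) := by
    calc Vᴴ * A 1 = Vᴴ * (A 1 * A 0) * A 0 := by
          rw [Matrix.mul_assoc, Matrix.mul_assoc (A 1), (hA 0).2, Matrix.mul_one]
      _ = Vᴴ * V * Matrix.diagonal (star μ) * (Vᴴ * A 0) := by
          rw [hD']; simp only [Matrix.mul_assoc]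
      _ = _ := by rw [hVV, Matrix.one_mul]
  have h00 : Vᴴ * A 0 * A 0 = Vᴴ := by rw [Matrix.mul_assoc, (hA 0).2, Matrix.mul_one]
  refine ⟨pairKraus (A 0) V, μ, sum_conjTranspose_pairKraus_mul_self (hA 0) hV, fun i => ?_,
    fun i a => ?_⟩
  · rw [hμ]; simp [Complex.norm_exp]
  · have hrow : ∀ (M B : Matrix ι ι ℂ) (j : ι),
        ∑ k, ((1 / √2 : ℝ) : ℂ) * M i k * B k j = ((1 / √2 : ℝ) : ℂ) * (M * B) i j := by
      intro M B j
      rw [Matrix.mul_apply, Finset.mul_sum]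
      exact Finset.sum_congr rfl fun _ _ => by ring
    ext r j
    fin_cases a <;> fin_cases r <;>
      rw [Matrix.mul_apply, Matrix.mul_apply] <;>
      simp only [Fin.sum_univ_two, pairKraus, qubitObservables, Matrix.of_apply, Matrix.cons_val_zero,
        Matrix.cons_val_one, Matrix.cons_val', Fin.zero_eta, Fin.mk_one, Fin.isValue,
        Matrix.cons_val_fin_one, zero_mul, one_mul, zero_add, add_zero]
    · exact hrow _ _ _
    · rw [hrow, h00]
    · rw [hrow, h1, Matrix.diagonal_mul]; simp only [Pi.star_apply]; ring
    · rw [hrow, h01, Matrix.diagonal_mul]; ring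

/-! ### Splitting the CHSH value along local instruments -/

theorem kronecker_mul_chshOperator {ι κ ι' κ' : Type*} [Fintype ι] [Fintype κ] [Fintype ι']
    [Fintype κ'] {A : Fin 2 → Matrix ι ι ℂ} {B : Fin 2 → Matrix κ κ ℂ}
    {A' : Fin 2 → Matrix ι' ι' ℂ} {B' : Fin 2 → Matrix κ' κ' ℂ}
    {K : Matrix ι' ι ℂ} {L : Matrix κ' κ ℂ} (hK : ∀ a, K * A a = A' a * K)
    (hL : ∀ b, L * B b = B' b * L) :
    (K ⊗ₖ L) * chshOperator A B = chshOperator A' B' * (K ⊗ₖ L) := by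
  simp only [chshOperator, Fin.sum_univ_two, Matrix.mul_add, Matrix.add_mul, Matrix.mul_smul,
    Matrix.smul_mul, ← Matrix.mul_kronecker_mul, hK, hL]

theorem sum_kronecker_conjTranspose_mul_self {ι κ ι' κ' α β : Type*} [Fintype ι'] [Fintype κ']
    [DecidableEq ι] [DecidableEq κ] [Fintype α] [Fintype β]
    {K : α → Matrix ι' ι ℂ} {L : β → Matrix κ' κ ℂ} (hK : ∑ i, (K i)ᴴ * K i = 1)
    (hL : ∑ j, (L j)ᴴ * L j = 1) :
    ∑ i, ∑ j, (K i ⊗ₖ L j)ᴴ * (K i ⊗ₖ L j) = 1 := by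
  simp only [Matrix.conjTranspose_kronecker, ← Matrix.mul_kronecker_mul]
  rw [← Matrix.one_kronecker_one, ← hK, ← hL]
  ext x y
  simp [Matrix.sum_apply, Finset.sum_mul_sum]

theorem trace_mul_eq_sum_trace_conjMap {ι ι' α β : Type*} [Fintype ι] [Fintype ι']
    [DecidableEq ι] [Fintype α] [Fintype β] {M : α → β → Matrix ι' ι ℂ}
    (hM : ∑ i, ∑ j, (M i j)ᴴ * M i j = 1) (C : Matrix ι ι ℂ) (C' : α → β → Matrix ι' ι' ℂ)
    (hC : ∀ i j, M i j * C = C' i j * M i j) (ρ : Matrix ι ι ℂ) :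
    (C * ρ).trace = ∑ i, ∑ j, (C' i j * conjMap (M i j) ρ).trace := by
  have h : ∀ i j, (C' i j * conjMap (M i j) ρ).trace = ((M i j)ᴴ * M i j * (C * ρ)).trace := by
    intro i j
    simp only [conjMap, LinearMap.coe_mk, AddHom.coe_mk]
    rw [← Matrix.mul_assoc, ← Matrix.mul_assoc, ← hC, Matrix.trace_mul_comm]
    simp only [Matrix.mul_assoc]
  simp only [h, ← Matrix.trace_sum, ← Finset.sum_mul, hM, Matrix.one_mul]

end

/-! ### The two-qubit inequality -/

noncomputable section

theorem fidelity_phiPlusProj_eq {σ : Matrix (Fin 2 × Fin 2) (Fin 2 × Fin 2) ℂ}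
    (hσ : σ.PosSemidef) :
    fidelity σ phiPlusProj =
      ((σ (0, 0) (0, 0)).re + (σ (1, 1) (1, 1)).re) / 2 + (σ (0, 0) (1, 1)).re := by
  rw [phiPlusProj, fidelity_vecMulVec hσ]
  have h : (σ (1, 1) (0, 0)).re = (σ (0, 0) (1, 1)).re := by
    rw [← hσ.1.apply]; simp
  have hsq : ((√2:ℝ):ℂ)⁻¹ * ((√2:ℝ):ℂ)⁻¹ = ((1 / 2 : ℝ) : ℂ) := by
    rw [← mul_inv, ← Complex.ofReal_mul, Real.mul_self_sqrt (by norm_num)]; norm_num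
  have h2 : (star phiPlus ⬝ᵥ (σ *ᵥ phiPlus)) = ((1 / 2 : ℝ) : ℂ) *
      (σ (0, 0) (0, 0) + σ (0, 0) (1, 1) + (σ (1, 1) (0, 0) + σ (1, 1) (1, 1))) := by
    rw [← hsq]
    simp [phiPlus, dotProduct, Matrix.mulVec, Fintype.sum_prod_type]
    ring
  rw [h2, Complex.re_ofReal_mul]
  simp only [Complex.add_re, h]
  ring

/-- Fidelity with a pure state is linear on positive semidefinite matrices; this lets an LOCC
protocol be analysed outcome by outcome. -/
theorem fidelity_phiPlusProj_sum {α : Type*} [Fintype α]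
    {σ : α → Matrix (Fin 2 × Fin 2) (Fin 2 × Fin 2) ℂ} (hσ : ∀ i, (σ i).PosSemidef) :
    fidelity (∑ i, σ i) phiPlusProj = ∑ i, fidelity (σ i) phiPlusProj := by
  rw [fidelity_phiPlusProj_eq (Matrix.posSemidef_sum _ fun i _ => hσ i)]
  simp only [fun i => fidelity_phiPlusProj_eq (hσ i), Matrix.sum_apply, Complex.re_sum,
    Finset.sum_add_distrib, ← Finset.sum_div]

/-- Nonnegativity of a principal 2 × 2 minor, followed by AM-GM. -/
theorem two_mul_norm_apply_le {ι : Type*} [Fintype ι] [DecidableEq ι] {σ : Matrix ι ι ℂ}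
    (hσ : σ.PosSemidef) (i j : ι) : 2 * ‖σ i j‖ ≤ (σ i i).re + (σ j j).re := by
  have hd := (hσ.submatrix ![i, j]).det_nonneg
  have hi := hσ.diag_nonneg (i := i)
  have hj := hσ.diag_nonneg (i := j)
  rw [Matrix.det_fin_two] at hd
  simp only [Matrix.submatrix_apply, Matrix.cons_val_zero, Matrix.cons_val_one] at hd
  rw [← hσ.1.apply j i, Complex.star_def, Complex.mul_conj] at hd
  rw [Complex.le_def] at hd hi hj
  have h1 := hd.1
  simp only [Complex.sub_re, Complex.mul_re, Complex.ofReal_re, ← hi.2, ← hj.2,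
    Complex.normSq_eq_norm_sq, Complex.zero_re, Complex.zero_im] at h1 hi hj
  nlinarith [norm_nonneg (σ i j), sq_nonneg ((σ i i).re - (σ j j).re), hi.1, hj.1]

theorem chshValue_qubitObservables_le {σ : Matrix (Fin 2 × Fin 2) (Fin 2 × Fin 2) ℂ}
    (hσ : σ.PosSemidef) {μ ν : ℂ} (hμ : ‖μ‖ = 1) (hν : ‖ν‖ = 1) :
    ∃ α β : ℝ, 0 ≤ α ∧ 0 ≤ β ∧ α ^ 2 + β ^ 2 = 8 ∧
      chshValue (qubitObservables μ) (qubitObservables ν) σ ≤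
        2 * α * ‖σ (0, 0) (1, 1)‖ + 2 * β * ‖σ (0, 1) (1, 0)‖ := by
  -- The moduli of the antidiagonal CHSH entries, `(1 + μ) + ν(1 - μ)` and `(1 + μ) + ν̄(1 - μ)`.
  -- The cross terms of their squares cancel because `(1 + μ)(1 - μ̄)` is imaginary, leaving `2(|1 +
  -- μ|² + |1 - μ|²) = 8`.
  refine ⟨‖1 + ν + μ - μ * ν‖, ‖1 + star ν + μ - μ * star ν‖, norm_nonneg _, norm_nonneg _, ?_, ?_⟩
  · rw [← Complex.normSq_eq_norm_sq, ← Complex.normSq_eq_norm_sq]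
    have h1 : μ.re * μ.re + μ.im * μ.im = 1 := by
      rw [← Complex.normSq_apply, Complex.normSq_eq_norm_sq, hμ]; norm_num
    have h2 : ν.re * ν.re + ν.im * ν.im = 1 := by
      rw [← Complex.normSq_apply, Complex.normSq_eq_norm_sq, hν]; norm_num
    simp only [Complex.normSq_apply, Complex.add_re, Complex.sub_re, Complex.mul_re,
      Complex.add_im, Complex.sub_im, Complex.mul_im, Complex.one_re, Complex.one_im,
      Complex.star_def, Complex.conj_re, Complex.conj_im]
    linear_combination (2 + 2 * (ν.re * ν.re + ν.im * ν.im) - 4 * ν.re) * h1 + (4 - 4 * μ.re) * h2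
  · have e1 : σ (1, 1) (0, 0) = star (σ (0, 0) (1, 1)) := (hσ.1.apply _ _).symm
    have e2 : σ (1, 0) (0, 1) = star (σ (0, 1) (1, 0)) := (hσ.1.apply _ _).symm
    have h : chshValue (qubitObservables μ) (qubitObservables ν) σ =
        2 * ((1 + ν + μ - μ * ν) * σ (0, 0) (1, 1)).re +
          2 * ((1 + star ν + μ - μ * star ν) * σ (0, 1) (1, 0)).re := by
      simp only [chshValue, Matrix.trace, Matrix.diag_apply, Matrix.mul_apply, chshOperator,
        Fintype.sum_prod_type, Fin.sum_univ_two, Matrix.add_apply, Matrix.smul_apply,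
        Matrix.kroneckerMap_apply, qubitObservables, Matrix.of_apply, Matrix.cons_val_zero,
        Matrix.cons_val_one, Matrix.cons_val', Matrix.cons_val_fin_one, e1, e2]
      simp
      ring
    rw [h]
    have h1 := (Complex.re_le_norm ((1 + ν + μ - μ * ν) * σ (0, 0) (1, 1)))
    have h2 := (Complex.re_le_norm ((1 + star ν + μ - μ * star ν) * σ (0, 1) (1, 0)))
    rw [norm_mul] at h1 h2
    linarith

/-- Here `q, r` are the weights of the blocks {00, 11} and {01, 10}, and `x, y` their coherences.
Cauchy–Schwarz bounds the left side by `2√(p² + u²)`, with `p` the trace and `u` the excess `2F - p`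
of the better-weighted block's protocol; this is convex in `u`, so on `[0, p]` it lies below its
chord `2p + 2(√2 - 1)u`. -/
theorem le_of_sq_add_sq_eq_eight {α β x y q r F : ℝ} (hα : 0 ≤ α) (hβ : 0 ≤ β)
    (h : α ^ 2 + β ^ 2 = 8) (hx : 2 * x ≤ q) (hy : 2 * y ≤ r) (hqr : 0 ≤ q + r)
    (h1 : q / 2 + x ≤ F) (h2 : r / 2 + y ≤ F) (h3 : (q + r) / 2 ≤ F) (hr : 0 ≤ r) (hq : 0 ≤ q) :
    2 * α * x + 2 * β * y ≤ 2 * (q + r) + 2 * (√2 - 1) * (2 * F - (q + r)) := by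
  wlog hle : β ≤ α generalizing α β x y q r
  · have := this hβ hα (by linarith) hy hx (by linarith) h2 h1 (by linarith) hq hr
      (le_of_not_ge hle)
    linarith
  have hs : √2 * √2 = 2 := Real.mul_self_sqrt (by norm_num)
  have hs1 : 1 < √2 := by nlinarith [Real.sqrt_nonneg 2]
  set p := q + r with hp
  set u := 2 * (q / 2 + x) - p with hu
  have hup : u ≤ p := by linarith
  have hS : 2 * α * x + 2 * β * y ≤ (α + β) / 2 * p + (α - β) / 2 * u := by
    have := mul_le_mul_of_nonneg_left hy hβ
    have h4 := mul_nonneg (sub_nonneg.2 hle) (sub_nonneg.2 hx)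
    rw [hu, hp]
    nlinarith
  have hsum : α + β ≤ 4 := by nlinarith [sq_nonneg (α - β)]
  -- For negative `u` the protocol gains nothing over a fresh product state: `α + β ≤ 4` bounds the
  -- left side by `2p`, and `h3` supplies `p ≤ 2F`.
  rcases le_total u 0 with hu0 | hu0
  · have h5 := mul_nonneg (sub_nonneg.2 hle) (neg_nonneg.2 hu0)
    have h6 := mul_nonneg (sub_nonneg.2 hsum) hqr
    have h7 : 0 ≤ (√2 - 1) * (2 * F - p) := mul_nonneg (by linarith) (by linarith)
    linarith
  · have hsq : ((α + β) / 2 * p + (α - β) / 2 * u) ^ 2 ≤ 4 * (p ^ 2 + u ^ 2) := by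
      have := sq_nonneg ((α + β) / 2 * u - (α - β) / 2 * p)
      have e : ((α + β) / 2) ^ 2 + ((α - β) / 2) ^ 2 = 4 := by linarith
      have e' : (((α + β) / 2) ^ 2 + ((α - β) / 2) ^ 2) * (p ^ 2 + u ^ 2) = 4 * (p ^ 2 + u ^ 2) := by
        rw [e]
      linarith
    have hchord : 4 * (p ^ 2 + u ^ 2) ≤ (2 * p + 2 * (√2 - 1) * u) ^ 2 := by
      have : 0 ≤ (√2 - 1) * (u * (p - u)) :=
        mul_nonneg (by linarith) (mul_nonneg hu0 (by linarith))
      have e : (2 * p + 2 * (√2 - 1) * u) ^ 2 - 4 * (p ^ 2 + u ^ 2) =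
          8 * ((√2 - 1) * (u * (p - u))) := by linear_combination 4 * u ^ 2 * hs
      linarith
    have h8 : 0 ≤ (√2 - 1) * u := mul_nonneg (by linarith) hu0
    have h9 := abs_le_of_sq_le_sq' (hsq.trans hchord) (by linarith)
    have h10 : 0 ≤ (√2 - 1) * (2 * F - p - u) := mul_nonneg (by linarith) (by linarith)
    linarith [h9.2]

/-! ### Two-qubit protocols -/

/-- A unitary on Alice's side followed by one on Bob's side is an LOCC map. -/
theorem isLOCC_unitary {a b : ℕ} {U : Matrix (Fin a) (Fin a) ℂ} {W : Matrix (Fin b) (Fin b) ℂ}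
    (hU : Uᴴ * U = 1) (hW : Wᴴ * W = 1) : IsLOCC a b a b (conjMap (U ⊗ₖ W)) := by
  have h := IsLOCC.alice (k := 1) (fun _ => a) (fun _ => U) (by simpa using hU) _ fun _ =>
    IsLOCC.bob (k := 1) (fun _ => b) (fun _ => W) (by simpa using hW) _ fun _ =>
      IsLOCC.done (c := a) (d := b)
  convert h using 1
  refine LinearMap.ext fun ρ => ?_
  simp only [Fin.sum_univ_one, LinearMap.comp_apply, LinearMap.id_apply, conjMap,
    LinearMap.coe_mk, AddHom.coe_mk]
  have e : U ⊗ₖ W =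
      ((1 : Matrix (Fin a) (Fin a) ℂ) ⊗ₖ W) * (U ⊗ₖ (1 : Matrix (Fin b) (Fin b) ℂ)) := by
    rw [← Matrix.mul_kronecker_mul, Matrix.one_mul, Matrix.mul_one]
  rw [e, Matrix.conjTranspose_mul]
  simp only [Matrix.mul_assoc]

/-- Both parties discard their qubits and prepare 0; the product state 00 has fidelity 1/2. -/
theorem exists_isLOCC_fidelity_eq_half_trace {σ : Matrix (Fin 2 × Fin 2) (Fin 2 × Fin 2) ℂ}
    (hσ : σ.PosSemidef) :
    ∃ Φ, IsLOCC 2 2 2 2 Φ ∧ fidelity (Φ σ) phiPlusProj = σ.trace.re / 2 := by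
  have h := IsLOCC.alice (fun _ => 2) _ (sum_single_conjTranspose_mul_self 2) _ fun _ =>
    IsLOCC.bob (fun _ => 2) _ (sum_single_conjTranspose_mul_self 2) _ fun _ => IsLOCC.done
  refine ⟨_, h, ?_⟩
  rw [fidelity_phiPlusProj_eq (h.posSemidef hσ)]
  simp [conjMap, Matrix.mul_apply, Fintype.sum_prod_type, Matrix.single_apply, Matrix.one_apply,
    Matrix.trace]

theorem exists_unit_mul_eq_norm (z : ℂ) : ∃ w : ℂ, star w * w = 1 ∧ w * z = (‖z‖ : ℂ) := by
  refine ⟨Complex.exp (-(Complex.arg z : ℂ) * Complex.I), ?_, ?_⟩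
  · rw [Complex.star_def, Complex.conj_mul', Complex.norm_exp]; simp
  · nth_rewrite 2 [← Complex.norm_mul_exp_arg_mul_I z]
    rw [mul_left_comm, ← Complex.exp_add]; simp

/-- A phase on Alice's 0 makes the coherence between 00 and 11 real and nonnegative. -/
theorem exists_isLOCC_fidelity_eq {σ : Matrix (Fin 2 × Fin 2) (Fin 2 × Fin 2) ℂ}
    (hσ : σ.PosSemidef) :
    ∃ Φ, IsLOCC 2 2 2 2 Φ ∧ fidelity (Φ σ) phiPlusProj =
      ((σ (0, 0) (0, 0)).re + (σ (1, 1) (1, 1)).re) / 2 + ‖σ (0, 0) (1, 1)‖ := by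
  obtain ⟨w, hw, hz⟩ := exists_unit_mul_eq_norm (σ (0, 0) (1, 1))
  have hw1 : (starRingEnd ℂ) w * w = 1 := hw
  have h : IsLOCC 2 2 2 2 (conjMap (!![w, 0; 0, 1] ⊗ₖ 1)) := isLOCC_unitary
    (by ext i j; fin_cases i <;> fin_cases j <;> simp [Matrix.mul_apply, hw1]) (by simp)
  refine ⟨_, h, ?_⟩
  rw [fidelity_phiPlusProj_eq (h.posSemidef hσ), ← Complex.ofReal_re ‖_‖, ← hz]
  have hw' : w * σ (0, 0) (0, 0) * (starRingEnd ℂ) w = σ (0, 0) (0, 0) := by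
    linear_combination σ (0, 0) (0, 0) * hw1
  simp [conjMap, Matrix.mul_apply, Fintype.sum_prod_type, Matrix.one_apply, hw']

/-- Bob's bit flip carries the block {01, 10} to {00, 11}, and Alice's phase aligns its coherence.
-/
theorem exists_isLOCC_fidelity_eq' {σ : Matrix (Fin 2 × Fin 2) (Fin 2 × Fin 2) ℂ}
    (hσ : σ.PosSemidef) :
    ∃ Φ, IsLOCC 2 2 2 2 Φ ∧ fidelity (Φ σ) phiPlusProj =
      ((σ (0, 1) (0, 1)).re + (σ (1, 0) (1, 0)).re) / 2 + ‖σ (0, 1) (1, 0)‖ := by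
  obtain ⟨w, hw, hz⟩ := exists_unit_mul_eq_norm (σ (0, 1) (1, 0))
  have hw1 : (starRingEnd ℂ) w * w = 1 := hw
  have h : IsLOCC 2 2 2 2 (conjMap (!![w, 0; 0, 1] ⊗ₖ !![0, 1; 1, 0])) := isLOCC_unitary
    (by ext i j; fin_cases i <;> fin_cases j <;> simp [Matrix.mul_apply, hw1])
    (by ext i j; fin_cases i <;> fin_cases j <;> simp [Matrix.mul_apply])
  refine ⟨_, h, ?_⟩
  rw [fidelity_phiPlusProj_eq (h.posSemidef hσ), ← Complex.ofReal_re ‖_‖, ← hz]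
  have hw' : w * σ (0, 1) (0, 1) * (starRingEnd ℂ) w = σ (0, 1) (0, 1) := by
    linear_combination σ (0, 1) (0, 1) * hw1
  simp [conjMap, Matrix.mul_apply, Fintype.sum_prod_type, hw']

/-- For unnormalized two-qubit states some LOCC map reaches the claimed fidelity. -/
theorem exists_isLOCC_chshValue_le {σ : Matrix (Fin 2 × Fin 2) (Fin 2 × Fin 2) ℂ}
    (hσ : σ.PosSemidef) {μ ν : ℂ} (hμ : ‖μ‖ = 1) (hν : ‖ν‖ = 1) :
    ∃ Φ, IsLOCC 2 2 2 2 Φ ∧ chshValue (qubitObservables μ) (qubitObservables ν) σ ≤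
      2 * σ.trace.re + 2 * (√2 - 1) * (2 * fidelity (Φ σ) phiPlusProj - σ.trace.re) := by
  obtain ⟨α, β, hα, hβ, h8, hS⟩ := chshValue_qubitObservables_le hσ hμ hν
  obtain ⟨Φ₁, hΦ₁, h₁⟩ := exists_isLOCC_fidelity_eq hσ
  obtain ⟨Φ₂, hΦ₂, h₂⟩ := exists_isLOCC_fidelity_eq' hσ
  obtain ⟨Φ₃, hΦ₃, h₃⟩ := exists_isLOCC_fidelity_eq_half_trace hσ
  have hx := two_mul_norm_apply_le hσ (0, 0) (1, 1)
  have hy := two_mul_norm_apply_le hσ (0, 1) (1, 0)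
  have hx0 := norm_nonneg (σ (0, 0) (1, 1))
  have hy0 := norm_nonneg (σ (0, 1) (1, 0))
  have htr : σ.trace.re = ((σ (0, 0) (0, 0)).re + (σ (1, 1) (1, 1)).re) +
      ((σ (0, 1) (0, 1)).re + (σ (1, 0) (1, 0)).re) := by
    simp [Matrix.trace, Fintype.sum_prod_type]; ring
  rw [htr] at h₃
  have key := fun F => le_of_sq_add_sq_eq_eight (F := F) hα hβ h8 hx hy (by linarith)
  rw [htr]
  obtain ⟨Φ, hΦ, g₁, g₂, g₃⟩ : ∃ Φ, IsLOCC 2 2 2 2 Φ ∧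
      fidelity (Φ₁ σ) phiPlusProj ≤ fidelity (Φ σ) phiPlusProj ∧
      fidelity (Φ₂ σ) phiPlusProj ≤ fidelity (Φ σ) phiPlusProj ∧
      fidelity (Φ₃ σ) phiPlusProj ≤ fidelity (Φ σ) phiPlusProj := by
    rcases le_total (fidelity (Φ₁ σ) phiPlusProj) (fidelity (Φ₂ σ) phiPlusProj) with h | h
    · rcases le_total (fidelity (Φ₂ σ) phiPlusProj) (fidelity (Φ₃ σ) phiPlusProj) with h' | h'
      · exact ⟨Φ₃, hΦ₃, h.trans h', h', le_rfl⟩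
      · exact ⟨Φ₂, hΦ₂, h, le_rfl, h'⟩
    · rcases le_total (fidelity (Φ₁ σ) phiPlusProj) (fidelity (Φ₃ σ) phiPlusProj) with h' | h'
      · exact ⟨Φ₃, hΦ₃, h', h.trans h', le_rfl⟩
      · exact ⟨Φ₁, hΦ₁, le_rfl, h, h'⟩
  exact ⟨Φ, hΦ, hS.trans (key _ (h₁ ▸ g₁) (h₂ ▸ g₂) (h₃ ▸ g₃) (by linarith) (by linarith))⟩

end

/-! ### Assembling the protocol -/

theorem mainTheorem6 (m n : ℕ) (ρ : Matrix (Fin m × Fin n) (Fin m × Fin n) ℂ)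
    (hρ : IsDensityMatrix ρ) :
    (Smax ρ + 2 * √2 - 4) / (4 * (√2 - 1)) ≤ FLOCC ρ := by
  have hs1 : 1 < √2 := by
    rw [Real.lt_sqrt (by norm_num)]; norm_num
  rw [div_le_iff₀ (by linarith), ← sub_nonneg]
  suffices h : Smax ρ ≤ 2 + 2 * (√2 - 1) * (2 * FLOCC ρ - 1) by linarith
  refine csSup_le (chshValues_nonempty ρ) ?_
  rintro s ⟨A, B, hA, hB, rfl⟩
  obtain ⟨K, μ, hK, hμ, hKA⟩ := exists_qubit_reduction hA
  obtain ⟨L, ν, hL, hν, hLB⟩ := exists_qubit_reduction hB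
  set σ : Fin m → Fin n → Matrix (Fin 2 × Fin 2) (Fin 2 × Fin 2) ℂ :=
    fun i j => conjMap (K i ⊗ₖ L j) ρ with hσdef
  have hσ : ∀ i j, (σ i j).PosSemidef := fun i j => hρ.1.mul_mul_conjTranspose_same _
  choose Φ hΦ hle using fun i j => exists_isLOCC_chshValue_le (hσ i j) (hμ i) (hν j)
  have hM := sum_kronecker_conjTranspose_mul_self hK hL
  have htr : ∑ i, ∑ j, (σ i j).trace.re = 1 := by
    have := trace_mul_eq_sum_trace_conjMap hM 1 (fun _ _ => 1) (fun _ _ => by simp) ρ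
    simp only [Matrix.one_mul, hρ.2] at this
    have := congrArg Complex.re this
    simpa using this.symm
  have hS : chshValue A B ρ =
      ∑ i, ∑ j, chshValue (qubitObservables (μ i)) (qubitObservables (ν j)) (σ i j) := by
    rw [chshValue, trace_mul_eq_sum_trace_conjMap hM _ _
      (fun i j => kronecker_mul_chshOperator (hKA i) (hLB j)) ρ]
    simp [chshValue, hσdef]
  -- Alice measures and announces `i`, Bob measures and announces `j`, and they run the two-qubit
  -- protocol chosen for `σ i j`.
  have hΨ := IsLOCC.alice (fun _ => 2) K hK _ fun i => IsLOCC.bob (fun _ => 2) L hL _ fun j => hΦ i j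
  set Ψ := ∑ i, (∑ j, (Φ i j).comp (conjMap ((1 : Matrix (Fin 2) (Fin 2) ℂ) ⊗ₖ L j))).comp
    (conjMap (K i ⊗ₖ (1 : Matrix (Fin n) (Fin n) ℂ))) with hΨdef
  have hΨρ : Ψ ρ = ∑ i, ∑ j, Φ i j (σ i j) := by
    have e : ∀ i j, K i ⊗ₖ L j = ((1 : Matrix (Fin 2) (Fin 2) ℂ) ⊗ₖ L j) *
        (K i ⊗ₖ (1 : Matrix (Fin n) (Fin n) ℂ)) := fun i j => by
      rw [← Matrix.mul_kronecker_mul, Matrix.one_mul, Matrix.mul_one]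
    simp only [hΨdef, LinearMap.sum_apply, LinearMap.comp_apply, hσdef, e, conjMap,
      LinearMap.coe_mk, AddHom.coe_mk, Matrix.conjTranspose_mul, Matrix.mul_assoc]
  have hF : ∑ i, ∑ j, fidelity (Φ i j (σ i j)) phiPlusProj ≤ FLOCC ρ := by
    have hpos : ∀ i j, (Φ i j (σ i j)).PosSemidef := fun i j => (hΦ i j).posSemidef (hσ i j)
    simp only [← fun i => fidelity_phiPlusProj_sum (hpos i)]
    rw [← fidelity_phiPlusProj_sum fun i => Matrix.posSemidef_sum _ fun j _ => hpos i j, ← hΨρ]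
    exact le_csSup (loccFidelities_bddAbove hρ) ⟨Ψ, hΨ, rfl⟩
  rw [hS]
  refine (Finset.sum_le_sum fun i _ => Finset.sum_le_sum fun j _ => hle i j).trans ?_
  simp only [Finset.sum_add_distrib, ← Finset.mul_sum, Finset.sum_sub_distrib, htr]
  have := mul_le_mul_of_nonneg_left hF (sub_nonneg.2 hs1.le)
  linarith
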